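/- **Setting.** Let $(Y,d_Y)$ be a compact metric space and $g:Y\to Y$ a continuous surjection satisfying Wieler's axioms with constants $\beta>0$, $K\in\mathbb N$, $K\geq 1$, $0<\gamma<1$: 1. if $d_Y(x,y)\le\beta$, then $d_Y(g^K(x),g^K(y))\le\gamma^K d_Y(g^{2K}(x),g^{2K}(y))$; 2. for all $x\in Y$ and $0<\epsilon\le\beta$, $g^K(B(g^K(x),\epsilon))\subseteq g^{2K}(B(x,\gamma\epsilon))$. Let $X=\varprojlim(Y,g)=\{\mathbf x=(x_n)_{n\ge 0} : g(x_{n+1})=x_n \text{ for all } n\}$, with the homeomorphism $\varphi(x_0,x_1,\dots)=(g(x_0),x_0,x_1,\dots)$ and the metric $d_X(\mathbf x,\mathbf y)=\sum_{i=0}^{K}\gamma^i\sup_{n}\gamma^n d_Y\big(\varphi^i(\mathbf x)_n,\varphi^i(\mathbf y)_n\big)$. Assume that $(X,\varphi)$ is mixing: for all non-empty open $U,V\subseteq X$ there is $N$ with $\varphi^n(U)\cap V\neq\emptyset$ for all $n\ge N$. Let $\mathbf P\subseteq X$ be a finite set with $\varphi(\mathbf P)=\mathbf P$, and let $X^u(\mathbf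 P)$ be the set of $\mathbf x\in X$ such that $d_X(\varphi^{-n}(\mathbf x),\varphi^{-n}(\mathbf p))\to 0$ for some $\mathbf p\in\mathbf P$. For $\mathbf x\in X$ and $\epsilon>0$ put $$X^u(\mathbf x,\epsilon)=\{\mathbf y\in X : d_Y(x_n,y_n)<\epsilon\ \text{for all } n, \text{ and } d_X(\mathbf x,\mathbf y)<\epsilon\},\qquad X^u(\mathbf P,\epsilon)=\bigcup_{\mathbf p\in\mathbf P}X^u(\mathbf p,\epsilon).$$ Give $X^u(\mathbf P)$ the topology (not the subspace topology from $X$) in which $U\subseteq X^u(\mathbf P)$ is open if and only if for every $\mathbf x\in U$ there is $\delta>0$ with $X^u(\mathbf x,\delta)\cap X^u(\mathbf P)\subseteq U$. Fix $K_0\ge K$ such that $d_X(\mathbf x,\mathbf y)<\beta/4$ whenever $x_i=y_i$ for all $i\le K_0$, and fix $0<\epsilon_Y<\beta/4$ such that $\varphi^{K_0}(X^u(\mathbf x,\epsilon_Y))\subseteq X^u(\varphi^{K_0}(\mathbf x),\beta/4)$ for all $\mathbf x\in X$. Let $\pi_0(\mathbf x)=x_0$. For $\mathbf x,\mathbf y\in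 X^u(\mathbf P)$ write $\mathbf x\sim_0\mathbf y$ if $x_0=y_0$ and there are $0<\delta<\epsilon_Y$ and an open subset $U$ of $X^u(\mathbf P)$ with $U\subseteq X^u(\mathbf y,\epsilon_Y)$ and $\pi_0(X^u(\mathbf x,\delta)\cap X^u(\mathbf P))=\pi_0(U)$. **Proposition.** The relation $\sim_0$ is an equivalence relation on $X^u(\mathbf P)$, and the quotient space $X^u(\mathbf P)/{\sim_0}$ is compact. Moreover, there is an integer $K_2>0$ such that $\varphi^{K_2}\big(\overline{X^u(\mathbf P,\beta/2)}\big)$ (closure in $X^u(\mathbf P)$) is a compact subset of $X^u(\mathbf P)$ and every $\mathbf x\in X^u(\mathbf P)$ satisfies $\mathbf x\sim_0\tilde{\mathbf x}$ for some $\tilde{\mathbf x}\in\varphi^{K_2}\big(X^u(\mathbf P,\beta/2)\big)$. The quotient map $X^u(\mathbf P)\to X^u(\mathbf P)/{\sim_0}$ is a local homeomorphism, and $X^u(\mathbf P)/{\sim_0}$ is locally Hausdorff, that is, each of its points has an open neighbourhood that is Hausdorff. -/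

import Mathlib

open Set Filter Topology

noncomputable section

/-- A compact metric space `Y` with a continuous surjection `g` satisfying Wieler's axioms with
constants `β`, `K`, `γ`. -/
structure WielerSystem (Y : Type*) [MetricSpace Y] where
  g : Y → Y
  continuous_g : Continuous g
  surjective_g : Function.Surjective g
  β : ℝ
  K : ℕ
  γ : ℝ
  β_pos : 0 < β
  K_pos : 0 < K
  γ_pos : 0 < γ
  γ_lt_one : γ < 1
  axiom_one : ∀ x y : Y, dist x y ≤ β →
    dist (g^[K] x) (g^[K] y) ≤ γ ^ K * dist (g^[2 * K] x) (g^[2 * K] y)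
  axiom_two : ∀ (x : Y) (ε : ℝ), 0 < ε → ε ≤ β →
    g^[K] '' Metric.ball (g^[K] x) ε ⊆ g^[2 * K] '' Metric.ball x (γ * ε)

namespace WielerSystem

variable {Y : Type*} [MetricSpace Y]

/-- The inverse limit `X` of the stationary system `Y ← Y ← Y ← ⋯` with bonding maps `g`. -/
@[ext]
structure Solenoid (S : WielerSystem Y) where
  coord : ℕ → Y
  g_coord_succ : ∀ i, S.g (coord (i + 1)) = coord i

/-- The map `φ (x₀, x₁, …) = (g x₀, g x₁, …) = (g x₀, x₀, x₁, …)`, with inverse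
`(x₀, x₁, …) ↦ (x₁, x₂, …)`. -/
def shift (S : WielerSystem Y) : S.Solenoid ≃ S.Solenoid where
  toFun x := ⟨fun n => S.g (x.coord n), fun i => congrArg S.g (x.g_coord_succ i)⟩
  invFun x := ⟨fun n => x.coord (n + 1), fun i => x.g_coord_succ (i + 1)⟩
  left_inv x := by
    ext n
    exact x.g_coord_succ n
  right_inv x := by
    ext n
    exact x.g_coord_succ n

/-- `d'_X (x, y) = sup_n γ ^ n d_Y (x_n, y_n)`. -/
def preDist (S : WielerSystem Y) (x y : S.Solenoid) : ℝ :=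
  ⨆ n : ℕ, S.γ ^ n * dist (x.coord n) (y.coord n)

/-- `d_X (x, y) = ∑_{i = 0}^{K} γ ^ i d'_X (φ ^ i x, φ ^ i y)`. -/
def solenoidDist (S : WielerSystem Y) (x y : S.Solenoid) : ℝ :=
  ∑ i ∈ Finset.range (S.K + 1), S.γ ^ i * S.preDist (S.shift^[i] x) (S.shift^[i] y)

section Metric

variable (S : WielerSystem Y)

theorem preDist_nonneg (x y : S.Solenoid) : 0 ≤ S.preDist x y :=
  Real.iSup_nonneg fun n => mul_nonneg (pow_nonneg S.γ_pos.le n) dist_nonneg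

theorem bddAbove_preDist [CompactSpace Y] (x y : S.Solenoid) :
    BddAbove (range fun n : ℕ => S.γ ^ n * dist (x.coord n) (y.coord n)) := by
  refine ⟨Metric.diam (univ : Set Y), ?_⟩
  rintro _ ⟨n, rfl⟩
  have h1 : dist (x.coord n) (y.coord n) ≤ Metric.diam (univ : Set Y) :=
    Metric.dist_le_diam_of_mem isCompact_univ.isBounded (mem_univ _) (mem_univ _)
  have h2 : S.γ ^ n ≤ 1 := pow_le_one₀ S.γ_pos.le S.γ_lt_one.le
  calc S.γ ^ n * dist (x.coord n) (y.coord n) ≤ 1 * dist (x.coord n) (y.coord n) :=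
        mul_le_mul_of_nonneg_right h2 dist_nonneg
    _ ≤ _ := by rw [one_mul]; exact h1

theorem preDist_self (x : S.Solenoid) : S.preDist x x = 0 := by
  simp [preDist]

theorem preDist_comm (x y : S.Solenoid) : S.preDist x y = S.preDist y x := by
  simp only [preDist, dist_comm]

theorem preDist_triangle [CompactSpace Y] (x y z : S.Solenoid) :
    S.preDist x z ≤ S.preDist x y + S.preDist y z := by
  refine ciSup_le fun n => ?_
  have h1 := le_ciSup (S.bddAbove_preDist x y) n
  have h2 := le_ciSup (S.bddAbove_preDist y z) n
  have h3 : S.γ ^ n * dist (x.coord n) (z.coord n) ≤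
      S.γ ^ n * (dist (x.coord n) (y.coord n) + dist (y.coord n) (z.coord n)) :=
    mul_le_mul_of_nonneg_left (dist_triangle _ _ _) (pow_nonneg S.γ_pos.le n)
  simp only [preDist]
  linarith [mul_add (S.γ ^ n) (dist (x.coord n) (y.coord n)) (dist (y.coord n) (z.coord n))]

theorem preDist_le_solenoidDist (x y : S.Solenoid) : S.preDist x y ≤ S.solenoidDist x y := by
  have h := Finset.single_le_sum
    (f := fun i => S.γ ^ i * S.preDist (S.shift^[i] x) (S.shift^[i] y))
    (fun i _ => mul_nonneg (pow_nonneg S.γ_pos.le i) (S.preDist_nonneg _ _))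
    (Finset.mem_range.2 (Nat.succ_pos S.K))
  simpa [solenoidDist] using h

end Metric

/-- The metric `d_X` on the solenoid; the topology of `X` is the one it induces. -/
instance [CompactSpace Y] (S : WielerSystem Y) : MetricSpace S.Solenoid where
  dist := S.solenoidDist
  dist_self x := by simp [solenoidDist, preDist_self]
  dist_comm x y := by
    simp only [solenoidDist]
    exact Finset.sum_congr rfl fun i _ => by rw [preDist_comm]
  dist_triangle x y z := by
    simp only [solenoidDist, ← Finset.sum_add_distrib, ← mul_add]
    exact Finset.sum_le_sum fun i _ =>
      mul_le_mul_of_nonneg_left (S.preDist_triangle _ _ _) (pow_nonneg S.γ_pos.le i)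
  eq_of_dist_eq_zero {x y} h := by
    ext n
    have h0 : S.solenoidDist x y = 0 := h
    have h1 : S.γ ^ n * dist (x.coord n) (y.coord n) ≤ S.preDist x y :=
      le_ciSup (S.bddAbove_preDist x y) n
    have h2 := S.preDist_le_solenoidDist x y
    have h3 : 0 < S.γ ^ n := pow_pos S.γ_pos n
    have h4 : dist (x.coord n) (y.coord n) ≤ 0 := by
      by_contra hc
      have := mul_pos h3 (not_le.1 hc)
      linarith
    exact dist_le_zero.1 h4

variable [CompactSpace Y]

/-- `(X, φ)` is mixing. -/
def IsMixing (S : WielerSystem Y) : Prop :=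
  ∀ U V : Set S.Solenoid, IsOpen U → IsOpen V → U.Nonempty → V.Nonempty →
    ∃ N : ℕ, ∀ n ≥ N, ((S.shift^[n] '' U) ∩ V).Nonempty

/-- Unstable equivalence: `d_X (φ⁻ⁿ x, φ⁻ⁿ y) → 0`. -/
def UnstableEquiv (S : WielerSystem Y) (x y : S.Solenoid) : Prop :=
  Tendsto (fun n : ℕ => dist (S.shift.symm^[n] x) (S.shift.symm^[n] y)) atTop (𝓝 0)

/-- The local unstable set `X^u(x, ε)` of a Wieler solenoid (used for `0 < ε ≤ β / 2`). -/
def localUnstable (S : WielerSystem Y) (x : S.Solenoid) (ε : ℝ) : Set S.Solenoid :=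
  {y | (∀ n, dist (x.coord n) (y.coord n) < ε) ∧ dist x y < ε}

/-- The auxiliary constants `K₀` and `ε_Y` in the definition of `∼₀`. -/
structure AdmissibleConstants (S : WielerSystem Y) (K₀ : ℕ) (εY : ℝ) : Prop where
  K_le : S.K ≤ K₀
  dist_lt : ∀ x y : S.Solenoid, (∀ i ≤ K₀, x.coord i = y.coord i) → dist x y < S.β / 4
  pos : 0 < εY
  lt : εY < S.β / 4
  image_subset : ∀ x : S.Solenoid,
    S.shift^[K₀] '' S.localUnstable x εY ⊆ S.localUnstable (S.shift^[K₀] x) (S.β / 4)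

/-- The set `X^u(P)` of points unstably equivalent to a point of `P`, as a type of its own: it does
not carry the subspace topology of `X`. -/
@[ext]
structure UnstableSet (S : WielerSystem Y) (P : Set S.Solenoid) where
  point : S.Solenoid
  exists_unstableEquiv : ∃ p ∈ P, S.UnstableEquiv point p

namespace UnstableSet

variable {S : WielerSystem Y} {P : Set S.Solenoid}

/-- `X^u(x, ε)` as a subset of `X^u(P)`, for `x` in `X`. -/
def nhd (P : Set S.Solenoid) (x : S.Solenoid) (ε : ℝ) : Set (S.UnstableSet P) :=
  {y | y.point ∈ S.localUnstable x ε}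

theorem nhd_mono (x : S.Solenoid) {δ ε : ℝ} (h : δ ≤ ε) : nhd P x δ ⊆ nhd P x ε :=
  fun _ hy => ⟨fun n => (hy.1 n).trans_le h, hy.2.trans_le h⟩

/-- The topology of `X^u(P)`: the sets `X^u(x, δ)`, `δ > 0`, form a neighbourhood base at `x`. -/
instance : TopologicalSpace (S.UnstableSet P) where
  IsOpen U := ∀ x ∈ U, ∃ δ > 0, nhd P x.point δ ⊆ U
  isOpen_univ _ _ := ⟨1, one_pos, subset_univ _⟩
  isOpen_inter U V hU hV x hx := by
    obtain ⟨δ, hδ, h⟩ := hU x hx.1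
    obtain ⟨δ', hδ', h'⟩ := hV x hx.2
    exact ⟨min δ δ', lt_min hδ hδ', subset_inter
      ((nhd_mono _ (min_le_left _ _)).trans h) ((nhd_mono _ (min_le_right _ _)).trans h')⟩
  isOpen_sUnion s hs x := by
    rintro ⟨U, hU, hx⟩
    obtain ⟨δ, hδ, h⟩ := hs U hU x hx
    exact ⟨δ, hδ, h.trans (subset_sUnion_of_mem hU)⟩

/-- The projection `π₀ : X^u(P) → Y`, `x ↦ x₀`. -/
def proj (x : S.UnstableSet P) : Y := x.point.coord 0

/-- `X^u(P, ε)`, the union of the local unstable sets `X^u(p, ε)`, `p ∈ P`. -/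
def core (P : Set S.Solenoid) (ε : ℝ) : Set (S.UnstableSet P) :=
  ⋃ p ∈ P, nhd P p ε

/-- The restriction of `φ` to `X^u(P)`, for a `φ`-invariant set `P`. -/
def map (hP : S.shift '' P = P) (x : S.UnstableSet P) : S.UnstableSet P where
  point := S.shift x.point
  exists_unstableEquiv := by
    obtain ⟨p, hp, h⟩ := x.exists_unstableEquiv
    refine ⟨S.shift p, hP ▸ mem_image_of_mem _ hp, ?_⟩
    unfold UnstableEquiv at h ⊢
    rw [← tendsto_add_atTop_iff_nat 1]
    simpa [Function.iterate_succ_apply] using h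

/-- The relation `∼₀` on `X^u(P)`. -/
def SimZero (P : Set S.Solenoid) (εY : ℝ) (x y : S.UnstableSet P) : Prop :=
  proj x = proj y ∧
    ∃ δ : ℝ, 0 < δ ∧ δ < εY ∧ ∃ U : Set (S.UnstableSet P),
      IsOpen U ∧ U ⊆ nhd P y.point εY ∧ proj '' nhd P x.point δ = proj '' U

end UnstableSet

end WielerSystem

end

namespace WielerSystem

variable {Y : Type*} [MetricSpace Y] {S : WielerSystem Y}

namespace Solenoid

theorem iterate_coord_add (x : S.Solenoid) (i n : ℕ) :
    S.g^[i] (x.coord (n + i)) = x.coord n := by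
  induction i with
  | zero => rfl
  | succ i ih =>
    rw [Function.iterate_succ_apply, ← add_assoc, x.g_coord_succ, ih]

theorem shift_iterate_coord (x : S.Solenoid) (i n : ℕ) :
    (S.shift^[i] x).coord n = S.g^[i] (x.coord n) := by
  induction i with
  | zero => rfl
  | succ i ih =>
    rw [Function.iterate_succ_apply', Function.iterate_succ_apply', ← ih]
    rfl

theorem shift_symm_iterate_coord (x : S.Solenoid) (i n : ℕ) :
    (S.shift.symm^[i] x).coord n = x.coord (n + i) := by
  induction i generalizing n with
  | zero => rfl
  | succ i ih =>
    rw [Function.iterate_succ_apply']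
    change (S.shift.symm^[i] x).coord (n + 1) = _
    rw [ih, add_assoc, add_comm 1 i]

theorem ext_coord_mul {x y : S.Solenoid} (h : ∀ m, x.coord (m * S.K) = y.coord (m * S.K)) :
    x = y := by
  ext n
  have hn : n * S.K = n + (n * S.K - n) := by
    have := Nat.le_mul_of_pos_right n S.K_pos
    omega
  rw [← x.iterate_coord_add (n * S.K - n), ← y.iterate_coord_add (n * S.K - n), ← hn, h]

/-- A point of the solenoid is determined by a compatible choice of coordinates at the multiples
of `K`. -/
theorem exists_coord_mul (a : ℕ → Y) (ha : ∀ m, S.g^[S.K] (a (m + 1)) = a m) :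
    ∃ y : S.Solenoid, ∀ m, y.coord (m * S.K) = a m := by
  have hle : ∀ n, n ≤ n * S.K := fun n => Nat.le_mul_of_pos_right n S.K_pos
  have hit : ∀ j m, S.g^[j * S.K] (a (m + j)) = a m := by
    intro j
    induction j with
    | zero => intro m; simp
    | succ j ih =>
      intro m
      rw [Nat.succ_mul, Function.iterate_add_apply, ← add_assoc, ha, ih]
  refine ⟨⟨fun n => S.g^[n * S.K - n] (a n), fun n => ?_⟩, fun m => ?_⟩
  · have h1 : (n + 1) * S.K - (n + 1) + 1 = (n * S.K - n) + S.K := by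
      have := hle n
      have := S.K_pos
      rw [Nat.succ_mul]
      omega
    rw [← Function.iterate_succ_apply' S.g, Nat.succ_eq_add_one, h1, Function.iterate_add_apply, ha]
  · have h2 : m * S.K * S.K - m * S.K = (m * S.K - m) * S.K := by rw [Nat.sub_mul]
    have h3 : m * S.K = m + (m * S.K - m) := by
      have := hle m
      omega
    change S.g^[m * S.K * S.K - m * S.K] (a (m * S.K)) = a m
    rw [h2]
    conv_lhs => rw [h3]
    have h4 : m + (m * S.K - m) - m = m * S.K - m := by omega
    rw [h4]
    exact hit _ _

theorem coord_surjective (y : Y) : ∃ x : S.Solenoid, x.coord 0 = y := by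
  choose f hf using S.surjective_g
  refine ⟨⟨fun n => f^[n] y, fun n => ?_⟩, rfl⟩
  rw [Function.iterate_succ_apply', hf]

end Solenoid

/-- Axiom 1 along the coordinates of two points of the solenoid. -/
theorem dist_coord_add_le {x y : S.Solenoid} (h : ∀ n, dist (x.coord n) (y.coord n) ≤ S.β) (n : ℕ) :
    dist (x.coord (n + S.K)) (y.coord (n + S.K)) ≤
      S.γ ^ S.K * dist (x.coord n) (y.coord n) := by
  have h1 := S.axiom_one _ _ (h (n + 2 * S.K))
  have e : ∀ z : S.Solenoid, S.g^[S.K] (z.coord (n + 2 * S.K)) = z.coord (n + S.K) := fun z => by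
    rw [two_mul, ← add_assoc, z.iterate_coord_add]
  rwa [e, e, x.iterate_coord_add, y.iterate_coord_add] at h1

theorem dist_coord_add_mul_le {x y : S.Solenoid} (h : ∀ n, dist (x.coord n) (y.coord n) ≤ S.β)
    (n m : ℕ) :
    dist (x.coord (n + m * S.K)) (y.coord (n + m * S.K)) ≤
      (S.γ ^ S.K) ^ m * dist (x.coord n) (y.coord n) := by
  induction m with
  | zero => simp
  | succ m ih =>
    have h1 := dist_coord_add_le h (n + m * S.K)
    rw [Nat.succ_mul, ← add_assoc, pow_succ', mul_assoc]
    exact h1.trans (mul_le_mul_of_nonneg_left ih (pow_nonneg S.γ_pos.le _))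

theorem dist_coord_add_mul_le_dist {x y : S.Solenoid}
    (h : ∀ n, dist (x.coord n) (y.coord n) ≤ S.β) (n m : ℕ) :
    dist (x.coord (n + m * S.K)) (y.coord (n + m * S.K)) ≤ dist (x.coord n) (y.coord n) :=
  (dist_coord_add_mul_le h n m).trans (mul_le_of_le_one_left dist_nonneg
    (pow_le_one₀ (pow_nonneg S.γ_pos.le _) (pow_le_one₀ S.γ_pos.le S.γ_lt_one.le)))

theorem eq_of_coord_zero_eq {x y : S.Solenoid} (h : ∀ n, dist (x.coord n) (y.coord n) ≤ S.β)
    (h0 : x.coord 0 = y.coord 0) : x = y := by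
  refine Solenoid.ext_coord_mul fun m => ?_
  have := dist_coord_add_mul_le_dist h 0 m
  rw [h0, dist_self, zero_add] at this
  exact dist_le_zero.1 this

/-- The contraction makes the supremum of the coordinate distances a maximum. -/
theorem exists_dist_coord_le_lt {x y : S.Solenoid} {δ : ℝ} (hδ : δ ≤ S.β)
    (h : ∀ n, dist (x.coord n) (y.coord n) < δ) :
    ∃ r < δ, ∀ n, dist (x.coord n) (y.coord n) ≤ r := by
  have hne : (Finset.range S.K).Nonempty := ⟨0, Finset.mem_range.2 S.K_pos⟩
  refine ⟨(Finset.range S.K).sup' hne fun n => dist (x.coord n) (y.coord n),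
    (Finset.sup'_lt_iff hne).2 fun n _ => h n, fun n => ?_⟩
  have h1 := dist_coord_add_mul_le_dist (fun n => (h n).le.trans hδ) (n % S.K) (n / S.K)
  rw [Nat.mod_add_div'] at h1
  exact h1.trans (Finset.le_sup' (fun n => dist (x.coord n) (y.coord n))
    (Finset.mem_range.2 (Nat.mod_lt _ S.K_pos)))

/-- Iterated use of axiom 2: a point near `g^[m K] b` can be pulled back along the orbit of `b`. -/
theorem exists_pullback_orbit {b y : Y} {ε : ℝ} (hε : 0 < ε) (hεβ : ε ≤ S.β) (m : ℕ)
    (h : dist y (S.g^[m * S.K] b) < ε) :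
    ∃ z, dist z b < S.γ ^ m * ε ∧ S.g^[(m + 1) * S.K] z = S.g^[S.K] y := by
  induction m generalizing b with
  | zero => exact ⟨y, by simpa using h, by simp⟩
  | succ m ih =>
    rw [Nat.succ_mul, Function.iterate_add_apply] at h
    obtain ⟨z, hz, hzy⟩ := ih h
    have hpos : 0 < S.γ ^ m * ε := mul_pos (pow_pos S.γ_pos m) hε
    have hle : S.γ ^ m * ε ≤ S.β :=
      (mul_le_of_le_one_left hε.le (pow_le_one₀ S.γ_pos.le S.γ_lt_one.le)).trans hεβ
    obtain ⟨w, hw, hwz⟩ := S.axiom_two b _ hpos hle ⟨z, hz, rfl⟩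
    refine ⟨w, ?_, ?_⟩
    · rw [pow_succ', mul_assoc]
      exact hw
    · have : (m + 1 + 1) * S.K = m * S.K + 2 * S.K := by ring
      rw [this, Function.iterate_add_apply, hwz, ← Function.iterate_add_apply, ← Nat.succ_mul]
      exact hzy

/-- Iterated use of axiom 2 along the coordinates of a point of the solenoid. -/
theorem exists_lift_of_dist_lt (x : S.Solenoid) {y : Y} {ε : ℝ} (hε : 0 < ε) (hεβ : ε ≤ S.β)
    (h : dist y (x.coord S.K) < ε) :
    ∃ w : S.Solenoid, w.coord 0 = S.g^[S.K] y ∧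
      ∀ m, ∃ z, dist z (x.coord ((m + 1) * S.K)) < ε ∧ w.coord (m * S.K) = S.g^[S.K] z := by
  have hpos : ∀ m, 0 < S.γ ^ m * ε := fun m => mul_pos (pow_pos S.γ_pos m) hε
  have hle : ∀ m, S.γ ^ m * ε ≤ ε := fun m =>
    mul_le_of_le_one_left hε.le (pow_le_one₀ S.γ_pos.le S.γ_lt_one.le)
  have hstep : ∀ m (z : Y), dist z (x.coord ((m + 1) * S.K)) < S.γ ^ m * ε →
      ∃ w, dist w (x.coord ((m + 1 + 1) * S.K)) < S.γ ^ (m + 1) * ε ∧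
        S.g^[2 * S.K] w = S.g^[S.K] z := by
    intro m z hz
    have e : S.g^[S.K] (x.coord ((m + 1 + 1) * S.K)) = x.coord ((m + 1) * S.K) := by
      rw [Nat.succ_mul (m + 1), x.iterate_coord_add]
    rw [← e] at hz
    obtain ⟨w, hw, hwz⟩ := S.axiom_two _ _ (hpos m) ((hle m).trans hεβ) ⟨z, hz, rfl⟩
    exact ⟨w, by rw [pow_succ', mul_assoc]; exact hw, hwz⟩
  choose! f hf hfg using hstep
  let a : ℕ → Y := fun m => Nat.rec y (fun m z => f m z) m
  have ha : ∀ m, dist (a m) (x.coord ((m + 1) * S.K)) < S.γ ^ m * ε := by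
    intro m
    induction m with
    | zero => simpa [a] using h
    | succ m ih => exact hf m _ ih
  obtain ⟨w, hw⟩ := Solenoid.exists_coord_mul (S := S) (fun m => S.g^[S.K] (a m)) fun m => by
    rw [← Function.iterate_add_apply, ← two_mul]
    exact hfg m _ (ha m)
  refine ⟨w, ?_, fun m => ⟨a m, (ha m).trans_le (hle m), hw m⟩⟩
  simpa [a] using hw 0

variable [CompactSpace Y]

theorem exists_dist_iterate_lt (S : WielerSystem Y) (N : ℕ) {ε : ℝ} (hε : 0 < ε) :
    ∃ δ > 0, ∀ j ≤ N, ∀ u v : Y, dist u v < δ → dist (S.g^[j] u) (S.g^[j] v) < ε := by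
  induction N with
  | zero =>
    refine ⟨ε, hε, fun j hj u v h => ?_⟩
    obtain rfl : j = 0 := by omega
    exact h
  | succ N ih =>
    obtain ⟨δ, hδ, h⟩ := ih
    obtain ⟨δ', hδ', h'⟩ := Metric.uniformContinuous_iff.1
      (CompactSpace.uniformContinuous_of_continuous (S.continuous_g.iterate (N + 1))) ε hε
    refine ⟨min δ δ', lt_min hδ hδ', fun j hj u v huv => ?_⟩
    rcases Nat.lt_or_ge j (N + 1) with hj' | hj'
    · exact h j (by omega) u v (huv.trans_le (min_le_left _ _))
    · obtain rfl : j = N + 1 := by omega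
      exact h' (huv.trans_le (min_le_right _ _))

theorem exists_dist_lt_of_coord (S : WielerSystem Y) {ε : ℝ} (hε : 0 < ε) :
    ∃ δ > 0, ∀ x y : S.Solenoid, (∀ n, dist (x.coord n) (y.coord n) < δ) → dist x y < ε := by
  obtain ⟨δ, hδ, h⟩ := S.exists_dist_iterate_lt S.K (ε := ε / (2 * (S.K + 1))) (by positivity)
  refine ⟨δ, hδ, fun x y hxy => ?_⟩
  have hterm : ∀ i ∈ Finset.range (S.K + 1),
      S.γ ^ i * S.preDist (S.shift^[i] x) (S.shift^[i] y) ≤ ε / (2 * (S.K + 1)) := by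
    intro i hi
    have h1 : S.preDist (S.shift^[i] x) (S.shift^[i] y) ≤ ε / (2 * (S.K + 1)) := by
      refine ciSup_le fun n => ?_
      rw [Solenoid.shift_iterate_coord, Solenoid.shift_iterate_coord]
      exact (mul_le_of_le_one_left dist_nonneg (pow_le_one₀ S.γ_pos.le S.γ_lt_one.le)).trans
        (h i (Nat.lt_succ_iff.1 (Finset.mem_range.1 hi)) _ _ (hxy n)).le
    exact (mul_le_of_le_one_left (S.preDist_nonneg _ _)
      (pow_le_one₀ S.γ_pos.le S.γ_lt_one.le)).trans h1
  have hsum := Finset.sum_le_sum hterm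
  rw [Finset.sum_const, Finset.card_range, nsmul_eq_mul] at hsum
  have e : ((S.K + 1 : ℕ) : ℝ) * (ε / (2 * (S.K + 1))) = ε / 2 := by
    push_cast
    field_simp
  rw [e] at hsum
  change S.solenoidDist x y < ε
  exact hsum.trans_lt (half_lt_self hε)

theorem exists_coord_lt_of_coord_mul (S : WielerSystem Y) {ε : ℝ} (hε : 0 < ε) :
    ∃ δ > 0, ∀ x y : S.Solenoid,
      (∀ m, dist (x.coord (m * S.K)) (y.coord (m * S.K)) < δ) →
        ∀ n, dist (x.coord n) (y.coord n) < ε := by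
  obtain ⟨δ, hδ, h⟩ := S.exists_dist_iterate_lt S.K hε
  refine ⟨δ, hδ, fun x y hxy n => ?_⟩
  have hlt := Nat.mod_lt n S.K_pos
  have e : (n / S.K + 1) * S.K = n + (S.K - n % S.K) := by
    have := Nat.mod_add_div' n S.K
    rw [Nat.succ_mul]
    omega
  have := h (S.K - n % S.K) (Nat.sub_le _ _) _ _ (hxy (n / S.K + 1))
  rwa [e, x.iterate_coord_add, y.iterate_coord_add] at this

theorem exists_mem_localUnstable_of_coord_zero (S : WielerSystem Y) {ε : ℝ} (hε : 0 < ε) :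
    ∃ δ > 0, ∀ x y : S.Solenoid, (∀ n, dist (x.coord n) (y.coord n) ≤ S.β) →
      dist (x.coord 0) (y.coord 0) < δ → y ∈ S.localUnstable x ε := by
  obtain ⟨δ₁, hδ₁, h₁⟩ := S.exists_dist_lt_of_coord hε
  obtain ⟨δ, hδ, h⟩ := S.exists_coord_lt_of_coord_mul (lt_min hε hδ₁)
  refine ⟨δ, hδ, fun x y hxy h0 => ?_⟩
  have h2 := h x y fun m => by
    have := dist_coord_add_mul_le_dist hxy 0 m
    rw [zero_add] at this
    exact this.trans_lt h0
  exact ⟨fun n => (h2 n).trans_le (min_le_left _ _),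
    h₁ x y fun n => (h2 n).trans_le (min_le_right _ _)⟩

theorem unstableEquiv_of_tendsto_coord {x y : S.Solenoid}
    (h : Tendsto (fun n => dist (x.coord n) (y.coord n)) atTop (𝓝 0)) : S.UnstableEquiv x y := by
  refine Metric.tendsto_atTop.2 fun ε hε => ?_
  obtain ⟨δ, hδ, hd⟩ := S.exists_dist_lt_of_coord hε
  obtain ⟨N, hN⟩ := Metric.tendsto_atTop.1 h δ hδ
  refine ⟨N, fun n hn => ?_⟩
  rw [dist_zero_right, Real.norm_of_nonneg dist_nonneg]
  refine hd _ _ fun m => ?_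
  have := hN (m + n) (by omega)
  rwa [dist_zero_right, Real.norm_of_nonneg dist_nonneg, ← Solenoid.shift_symm_iterate_coord,
    ← Solenoid.shift_symm_iterate_coord] at this

theorem unstableEquiv_of_dist_coord_le {x y : S.Solenoid}
    (h : ∀ n, dist (x.coord n) (y.coord n) ≤ S.β) : S.UnstableEquiv x y := by
  refine unstableEquiv_of_tendsto_coord (Metric.tendsto_atTop.2 fun ε hε => ?_)
  obtain ⟨m, hm⟩ := exists_pow_lt_of_lt_one (div_pos hε S.β_pos)
    (pow_lt_one₀ S.γ_pos.le S.γ_lt_one S.K_pos.ne')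
  refine ⟨m * S.K, fun n hn => ?_⟩
  rw [dist_zero_right, Real.norm_of_nonneg dist_nonneg]
  have h1 := dist_coord_add_mul_le h (n - m * S.K) m
  rw [Nat.sub_add_cancel hn] at h1
  refine h1.trans_lt ((mul_le_mul_of_nonneg_left (h _) (by have := S.γ_pos; positivity)).trans_lt ?_)
  rwa [lt_div_iff₀ S.β_pos] at hm

theorem UnstableEquiv.trans {x y z : S.Solenoid} (h : S.UnstableEquiv x y)
    (h' : S.UnstableEquiv y z) : S.UnstableEquiv x z := by
  refine squeeze_zero (fun _ => dist_nonneg)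
    (fun n => dist_triangle _ (S.shift.symm^[n] y) _) ?_
  simpa using Tendsto.add h h'

theorem self_mem_localUnstable (x : S.Solenoid) {ε : ℝ} (hε : 0 < ε) :
    x ∈ S.localUnstable x ε :=
  ⟨fun _ => by simpa using hε, by simpa using hε⟩

theorem dist_coord_le_of_mem_localUnstable {x y z : S.Solenoid} {ε : ℝ} (hε : ε ≤ S.β / 2)
    (hy : y ∈ S.localUnstable x ε) (hz : z ∈ S.localUnstable x ε) (n : ℕ) :
    dist (y.coord n) (z.coord n) ≤ S.β := by
  have := dist_triangle_left (y.coord n) (z.coord n) (x.coord n)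
  linarith [hy.1 n, hz.1 n]

theorem continuous_coord (n : ℕ) : Continuous fun x : S.Solenoid => x.coord n := by
  refine Metric.continuous_iff.2 fun x ε hε => ⟨S.γ ^ n * ε, mul_pos (pow_pos S.γ_pos n) hε, ?_⟩
  intro y hy
  have h1 : S.γ ^ n * dist (y.coord n) (x.coord n) ≤ S.preDist y x :=
    le_ciSup (S.bddAbove_preDist y x) n
  have h2 : S.preDist y x ≤ dist y x := S.preDist_le_solenoidDist y x
  exact lt_of_mul_lt_mul_left (h1.trans_lt (h2.trans_lt hy)) (pow_nonneg S.γ_pos.le n)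

/-- Mixing of the solenoid makes every ball of `Y` expand onto all of `Y`. -/
theorem exists_iterate_image_ball_eq_univ (hmix : S.IsMixing) (b : Y) {δ : ℝ} (hδ : 0 < δ) :
    ∃ m, S.g^[m] '' Metric.ball b δ = univ := by
  have hβ := S.β_pos
  obtain ⟨t, htf, ht⟩ := Metric.totallyBounded_iff.1
    (isCompact_univ (X := Y)).totallyBounded (S.β / 2) (half_pos hβ)
  have hN : ∀ c : Y, ∃ N, ∀ n ≥ N,
      ∃ u ∈ Metric.ball b (δ / 2), S.g^[n] u ∈ Metric.ball c (S.β / 2) := by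
    intro c
    obtain ⟨x, hx⟩ := Solenoid.coord_surjective (S := S) b
    obtain ⟨y, hy⟩ := Solenoid.coord_surjective (S := S) c
    obtain ⟨N, hN⟩ := hmix _ _
      ((Metric.isOpen_ball (x := b) (ε := δ / 2)).preimage (continuous_coord (S := S) 0))
      ((Metric.isOpen_ball (x := c) (ε := S.β / 2)).preimage (continuous_coord (S := S) 0))
      ⟨x, by simp [hx, hδ]⟩ ⟨y, by simp [hy, hβ]⟩
    refine ⟨N, fun n hn => ?_⟩
    obtain ⟨_, ⟨u, hu, rfl⟩, hu'⟩ := hN n hn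
    exact ⟨u.coord 0, hu, by rw [← Solenoid.shift_iterate_coord]; exact hu'⟩
  choose N hN using hN
  obtain ⟨M, hM⟩ := (htf.image N).bddAbove
  obtain ⟨k, hk⟩ := exists_pow_lt_of_lt_one (div_pos (half_pos hδ) hβ) S.γ_lt_one
  rw [lt_div_iff₀ hβ] at hk
  refine ⟨(max M k + 1) * S.K, eq_univ_of_forall fun y => ?_⟩
  obtain ⟨y', rfl⟩ := S.surjective_g.iterate S.K y
  obtain ⟨c, hc, hcy⟩ := mem_iUnion₂.1 (ht (mem_univ y'))
  obtain ⟨u, hu, hu'⟩ := hN c (max M k * S.K)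
    ((hM (mem_image_of_mem N hc)).trans ((le_max_left _ _).trans
      (Nat.le_mul_of_pos_right _ S.K_pos)))
  have hyu : dist y' (S.g^[max M k * S.K] u) < S.β := by
    have := dist_triangle_right y' (S.g^[max M k * S.K] u) c
    have h1 := Metric.mem_ball.1 hcy
    have h2 := Metric.mem_ball.1 hu'
    linarith
  obtain ⟨z, hz, hzy⟩ := exists_pullback_orbit hβ le_rfl _ hyu
  refine ⟨z, ?_, hzy⟩
  have h3 : S.γ ^ (max M k) * S.β ≤ S.γ ^ k * S.β :=
    mul_le_mul_of_nonneg_right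
      (pow_le_pow_of_le_one S.γ_pos.le S.γ_lt_one.le (le_max_right _ _)) hβ.le
  have h4 := dist_triangle z u b
  have h5 := Metric.mem_ball.1 hu
  rw [Metric.mem_ball]
  linarith

end WielerSystem

namespace WielerSystem

namespace UnstableSet

variable {Y : Type*} [MetricSpace Y] [CompactSpace Y] {S : WielerSystem Y} {P : Set S.Solenoid}

theorem self_mem_nhd (x : S.UnstableSet P) {ε : ℝ} (hε : 0 < ε) : x ∈ nhd P x.point ε :=
  self_mem_localUnstable _ hε

theorem isOpen_nhd (x : S.Solenoid) {ε : ℝ} (hε : ε ≤ S.β) : IsOpen (nhd P x ε) := by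
  intro y hy
  obtain ⟨r, hr, h⟩ := exists_dist_coord_le_lt hε hy.1
  refine ⟨min (ε - r) (ε - dist x y.point), lt_min (sub_pos.2 hr) (sub_pos.2 hy.2), fun z hz =>
    ⟨fun n => ?_, ?_⟩⟩
  · have h1 := (hz.1 n).trans_le (min_le_left _ _)
    have h2 := dist_triangle (x.coord n) (y.point.coord n) (z.point.coord n)
    linarith [h n]
  · have h1 := hz.2.trans_le (min_le_right _ _)
    have h2 := dist_triangle x y.point z.point
    linarith

theorem hasBasis_nhds (x : S.UnstableSet P) :
    (𝓝 x).HasBasis (fun δ : ℝ => 0 < δ) (nhd P x.point) := by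
  refine ⟨fun U => ⟨fun hU => ?_, ?_⟩⟩
  · obtain ⟨V, hVU, hV, hx⟩ := mem_nhds_iff.1 hU
    obtain ⟨δ, hδ, h⟩ := hV x hx
    exact ⟨δ, hδ, h.trans hVU⟩
  · rintro ⟨δ, hδ, h⟩
    exact mem_of_superset ((isOpen_nhd _ (min_le_right δ S.β)).mem_nhds
      (self_mem_nhd x (lt_min hδ S.β_pos))) ((nhd_mono _ (min_le_left _ _)).trans h)

theorem nhd_mem_nhds (x : S.UnstableSet P) {ε : ℝ} (hε : 0 < ε) : nhd P x.point ε ∈ 𝓝 x :=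
  (hasBasis_nhds x).mem_of_mem hε

theorem continuous_coord (n : ℕ) : Continuous fun x : S.UnstableSet P => x.point.coord n := by
  refine continuous_iff_continuousAt.2 fun x => ((hasBasis_nhds x).tendsto_iff
    Metric.nhds_basis_ball).2 fun ε hε => ⟨ε, hε, fun y hy => ?_⟩
  rw [Metric.mem_ball, dist_comm]
  exact hy.1 n

theorem continuous_proj : Continuous (proj : S.UnstableSet P → Y) :=
  continuous_coord 0

instance : T2Space (S.UnstableSet P) :=
  T2Space.of_injective_continuous (f := fun (x : S.UnstableSet P) n => x.point.coord n)
    (fun _ _ h => UnstableSet.ext (Solenoid.ext h)) (continuous_pi continuous_coord)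

theorem dist_coord_le_of_mem_nhd {x : S.Solenoid} {ε : ℝ} (hε : ε ≤ S.β / 2) :
    ∀ y ∈ nhd P x ε, ∀ z ∈ nhd P x ε, ∀ n,
      dist (y.point.coord n) (z.point.coord n) ≤ S.β :=
  fun _ hy _ hz => dist_coord_le_of_mem_localUnstable hε hy hz

theorem injOn_proj {A : Set (S.UnstableSet P)}
    (hA : ∀ y ∈ A, ∀ z ∈ A, ∀ n, dist (y.point.coord n) (z.point.coord n) ≤ S.β) :
    InjOn proj A :=
  fun y hy z hz h => UnstableSet.ext (eq_of_coord_zero_eq (hA y hy z hz) h)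

/-- The inverse of `π₀` is continuous on a set whose points have coordinates at distance at most
`β`. -/
theorem comap_proj_inf_principal_le {B : Set (S.UnstableSet P)}
    (hB : ∀ y ∈ B, ∀ z ∈ B, ∀ n, dist (y.point.coord n) (z.point.coord n) ≤ S.β)
    {b : S.UnstableSet P} (hb : b ∈ B) : comap proj (𝓝 (proj b)) ⊓ 𝓟 B ≤ 𝓝 b := by
  refine (hasBasis_nhds b).ge_iff.2 fun ε hε => ?_
  obtain ⟨δ, hδ, h⟩ := S.exists_mem_localUnstable_of_coord_zero hε
  rw [mem_inf_principal]
  refine mem_of_superset (preimage_mem_comap (Metric.ball_mem_nhds _ hδ)) fun y hy hyB => ?_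
  exact h _ _ (hB b hb y hyB) (by rw [dist_comm]; exact hy)

/-- If `π₀ A ⊆ π₀ B` near `a`, then the germ of the image of `π₀` at `a` is contained in that at
`b`. -/
theorem map_proj_nhds_le {A B : Set (S.UnstableSet P)}
    (hB : ∀ y ∈ B, ∀ z ∈ B, ∀ n, dist (y.point.coord n) (z.point.coord n) ≤ S.β)
    {a b : S.UnstableSet P} (hA : A ∈ 𝓝 a) (hb : b ∈ B) (hab : proj a = proj b)
    (h : proj '' A ⊆ proj '' B) : Filter.map proj (𝓝 a) ≤ Filter.map proj (𝓝 b) := by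
  intro s hs
  have h1 := comap_proj_inf_principal_le hB hb (mem_map.1 hs)
  rw [mem_inf_principal, mem_comap] at h1
  obtain ⟨t, ht, hts⟩ := h1
  rw [← hab] at ht
  rw [mem_map]
  filter_upwards [continuous_proj.continuousAt ht, hA] with a' ha't ha'A
  obtain ⟨b', hb', e⟩ := h (mem_image_of_mem proj ha'A)
  have : b' ∈ proj ⁻¹' s := hts (by rw [mem_preimage, e]; exact ha't) hb'
  rwa [mem_preimage, e] at this

theorem proj_eq_of_map_proj_nhds_eq {x y : S.UnstableSet P}
    (h : Filter.map proj (𝓝 x) = Filter.map proj (𝓝 y)) : proj x = proj y :=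
  tendsto_nhds_unique (f := (id : Y → Y)) (l := Filter.map proj (𝓝 x)) continuous_proj.continuousAt
    (h ▸ continuous_proj.continuousAt)

/-- Points with the same germ have arbitrarily small neighbourhoods with the same image. -/
theorem exists_image_proj_eq {x y : S.UnstableSet P} (h : Filter.map proj (𝓝 x) = Filter.map proj (𝓝 y))
    {A B : Set (S.UnstableSet P)} (hA : A ∈ 𝓝 x) (hB : B ∈ 𝓝 y) {ε : ℝ} (hε : 0 < ε) :
    ∃ δ : ℝ, 0 < δ ∧ δ < ε ∧ nhd P x.point δ ⊆ A ∧ ∃ V ⊆ B, IsOpen V ∧ y ∈ V ∧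
      proj '' nhd P x.point δ = proj '' V := by
  have hβ := half_pos S.β_pos
  have hA' : A ∩ nhd P x.point (S.β / 2) ∈ 𝓝 x := inter_mem hA (nhd_mem_nhds x hβ)
  obtain ⟨A₁, hA₁, hA₁o, hxA₁⟩ := mem_nhds_iff.1 hA'
  have h1 : proj ⁻¹' (proj '' A₁) ∈ 𝓝 y := by
    rw [← mem_map, ← h]
    exact image_mem_map (hA₁o.mem_nhds hxA₁)
  obtain ⟨B₁, hB₁, hB₁o, hyB₁⟩ := mem_nhds_iff.1 (inter_mem hB h1)
  have h2 : proj ⁻¹' (proj '' B₁) ∈ 𝓝 x := by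
    rw [← mem_map, h]
    exact image_mem_map (hB₁o.mem_nhds hyB₁)
  obtain ⟨δ, hδ, hδs⟩ := (hasBasis_nhds x).mem_iff.1 (inter_mem h2 (hA₁o.mem_nhds hxA₁))
  set η := min δ (min (ε / 2) S.β)
  have hηpos : 0 < η := lt_min hδ (lt_min (half_pos hε) S.β_pos)
  have hηs := (nhd_mono (P := P) x.point (min_le_left δ (min (ε / 2) S.β))).trans hδs
  have hηo : IsOpen (nhd P x.point η) :=
    isOpen_nhd _ ((min_le_right _ _).trans (min_le_right _ _))
  have hsmall : ∀ y ∈ A₁, ∀ z ∈ A₁, ∀ n, dist (y.point.coord n) (z.point.coord n) ≤ S.β :=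
    fun y hy z hz => dist_coord_le_of_mem_nhd le_rfl y (hA₁ hy).2 z (hA₁ hz).2
  have hηε : η < ε :=
    ((min_le_right _ _).trans (min_le_left _ _)).trans_lt (half_lt_self hε)
  refine ⟨η, hηpos, hηε, fun z hz => (hA₁ (hηs hz).2).1,
    B₁ ∩ proj ⁻¹' (proj '' nhd P x.point η), fun z hz => (hB₁ hz.1).1, ?_, ?_, ?_⟩
  · refine isOpen_iff_mem_nhds.2 fun b hb => ?_
    obtain ⟨a, ha, hab⟩ := hb.2
    have h3 := comap_proj_inf_principal_le hsmall (hηs ha).2 (hηo.mem_nhds ha)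
    rw [mem_inf_principal, mem_comap] at h3
    obtain ⟨t, ht, hts⟩ := h3
    rw [hab] at ht
    filter_upwards [hB₁o.mem_nhds hb.1, continuous_proj.continuousAt ht] with b' hb' hb't
    obtain ⟨a', ha', e⟩ := (hB₁ hb').2
    exact ⟨hb', a', hts (by rw [mem_preimage, e]; exact hb't) ha', e⟩
  · exact ⟨hyB₁, x, self_mem_nhd x hηpos, proj_eq_of_map_proj_nhds_eq h⟩
  · refine Subset.antisymm ?_ ?_
    · rintro _ ⟨a, ha, rfl⟩
      obtain ⟨b, hb, e⟩ := (hηs ha).1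
      exact ⟨b, ⟨hb, a, ha, e.symm⟩, e⟩
    · rintro _ ⟨b, hb, rfl⟩
      exact hb.2

/-- `∼₀` is equality of the germs of the images of `π₀`. -/
theorem simZero_iff {εY : ℝ} (hpos : 0 < εY) (hlt : εY ≤ S.β / 2) {x y : S.UnstableSet P} :
    SimZero P εY x y ↔ Filter.map proj (𝓝 x) = Filter.map proj (𝓝 y) := by
  constructor
  · rintro ⟨h0, δ, hδ, hδε, U, hU, hUy, h⟩
    have hx := self_mem_nhd x hδ
    have hxs := dist_coord_le_of_mem_nhd (P := P) (x := x.point) (hδε.le.trans hlt)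
    have hys := dist_coord_le_of_mem_nhd (P := P) (x := y.point) hlt
    have hUs := fun u hu v hv => hys u (hUy hu) v (hUy hv)
    have hyU : y ∈ U := by
      obtain ⟨u, hu, e⟩ := h ▸ mem_image_of_mem proj hx
      rwa [← injOn_proj hys (hUy hu) (self_mem_nhd y hpos) (e.trans h0)]
    exact le_antisymm (map_proj_nhds_le hUs (nhd_mem_nhds x hδ) hyU h0 h.subset)
      (map_proj_nhds_le hxs (hU.mem_nhds hyU) hx h0.symm h.symm.subset)
  · intro h
    obtain ⟨δ, hδ, hδε, -, V, hVB, hV, -, e⟩ :=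
      exists_image_proj_eq h univ_mem (nhd_mem_nhds y hpos) hpos
    exact ⟨proj_eq_of_map_proj_nhds_eq h, δ, hδ, hδε, V, hV, hVB, e⟩

theorem equivalence_simZero {εY : ℝ} (hpos : 0 < εY) (hlt : εY ≤ S.β / 2) :
    Equivalence (SimZero P εY) where
  refl _ := (simZero_iff hpos hlt).2 rfl
  symm h := (simZero_iff hpos hlt).2 ((simZero_iff hpos hlt).1 h).symm
  trans h h' := (simZero_iff hpos hlt).2
    (((simZero_iff hpos hlt).1 h).trans ((simZero_iff hpos hlt).1 h'))

theorem isOpenMap_quot_mk {εY : ℝ} (hpos : 0 < εY) (hlt : εY ≤ S.β / 2) :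
    IsOpenMap (Quot.mk (SimZero P εY)) := by
  intro U hU
  have heq := equivalence_simZero (P := P) hpos hlt
  rw [← isQuotientMap_quot_mk.isOpen_preimage, isOpen_iff_mem_nhds]
  rintro y ⟨x, hxU, hxy⟩
  have hβ := half_pos S.β_pos
  have h := (simZero_iff hpos hlt).1 (heq.quot_mk_eq_iff x y |>.1 hxy)
  obtain ⟨δ, hδ, hδβ, hδU, V, hVB, hV, hyV, e⟩ :=
    exists_image_proj_eq h (hU.mem_nhds hxU) (nhd_mem_nhds y hβ) hβ
  have hVs := fun u hu v hv =>
    dist_coord_le_of_mem_nhd (P := P) (x := y.point) le_rfl u (hVB hu) v (hVB hv)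
  filter_upwards [hV.mem_nhds hyV] with v hv
  obtain ⟨u, hu, huv⟩ := e.symm ▸ mem_image_of_mem proj hv
  refine ⟨u, hδU hu, Quot.sound ((simZero_iff hpos hlt).2 (le_antisymm ?_ ?_))⟩
  · exact map_proj_nhds_le hVs
      ((isOpen_nhd _ (hδβ.le.trans (half_le_self S.β_pos.le))).mem_nhds hu) hv huv e.subset
  · exact map_proj_nhds_le (dist_coord_le_of_mem_nhd hδβ.le) (hV.mem_nhds hv) hu huv.symm
      e.symm.subset

theorem injOn_quot_mk {εY : ℝ} {A : Set (S.UnstableSet P)}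
    (hA : ∀ y ∈ A, ∀ z ∈ A, ∀ n, dist (y.point.coord n) (z.point.coord n) ≤ S.β)
    (heq : Equivalence (SimZero P εY)) : InjOn (Quot.mk (SimZero P εY)) A :=
  fun _ hy _ hz h => injOn_proj hA hy hz ((heq.quot_mk_eq_iff _ _).1 h).1

theorem isLocalHomeomorph_quot_mk {εY : ℝ} (hpos : 0 < εY) (hlt : εY ≤ S.β / 2) :
    IsLocalHomeomorph (Quot.mk (SimZero P εY)) := by
  refine isLocalHomeomorph_iff_isOpenEmbedding_restrict.2 fun x =>
    ⟨nhd P x.point (S.β / 2), nhd_mem_nhds x (half_pos S.β_pos), ?_⟩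
  exact IsOpenEmbedding.of_continuous_injective_isOpenMap
    (continuous_quot_mk.comp continuous_subtype_val)
    (injOn_quot_mk (dist_coord_le_of_mem_nhd le_rfl) (equivalence_simZero hpos hlt)).injective
    ((isOpenMap_quot_mk hpos hlt).comp
      (isOpen_nhd _ (half_le_self S.β_pos.le)).isOpenEmbedding_subtypeVal.isOpenMap)

theorem exists_isOpen_t2Space_quot {εY : ℝ} (hpos : 0 < εY) (hlt : εY ≤ S.β / 2)
    (z : Quot (SimZero P εY)) :
    ∃ V : Set (Quot (SimZero P εY)), IsOpen V ∧ z ∈ V ∧ T2Space V := by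
  obtain ⟨x, rfl⟩ := Quot.exists_rep z
  refine ⟨Quot.mk _ '' nhd P x.point (S.β / 2), isOpenMap_quot_mk hpos hlt _
    (isOpen_nhd _ (half_le_self S.β_pos.le)),
    mem_image_of_mem _ (self_mem_nhd x (half_pos S.β_pos)), ?_⟩
  let f : Quot (SimZero P εY) → Y := Quot.lift proj fun _ _ h => h.1
  have hf : Continuous f := continuous_quot_lift _ continuous_proj
  refine T2Space.of_injective_continuous (f := fun v => f v.1) ?_
    (hf.comp continuous_subtype_val)
  rintro ⟨_, a, ha, rfl⟩ ⟨_, b, hb, rfl⟩ h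
  have : a = b := injOn_proj (dist_coord_le_of_mem_nhd le_rfl) ha hb h
  subst this
  rfl

/-- The germ of the image of `π₀` at `x` only depends on the coordinate `x_K`. -/
theorem map_proj_nhds (x : S.UnstableSet P) :
    Filter.map proj (𝓝 x) = Filter.map (S.g^[S.K]) (𝓝 (x.point.coord S.K)) := by
  refine le_antisymm ?_ ?_
  · have : (proj : S.UnstableSet P → Y) = S.g^[S.K] ∘ fun x => x.point.coord S.K := by
      funext y
      have := y.point.iterate_coord_add S.K 0
      rw [zero_add] at this
      exact this.symm
    rw [this, ← map_map]
    exact map_mono (continuous_coord S.K).continuousAt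
  · intro s hs
    obtain ⟨ε₀, hε₀, hs⟩ := (hasBasis_nhds x).mem_iff.1 (mem_map.1 hs)
    obtain ⟨ε₁, hε₁, h₁⟩ := S.exists_dist_lt_of_coord hε₀
    obtain ⟨ε₂, hε₂, h₂⟩ :=
      S.exists_coord_lt_of_coord_mul (lt_min (lt_min hε₀ hε₁) S.β_pos)
    obtain ⟨ε, hε, h⟩ := S.exists_dist_iterate_lt S.K hε₂
    refine mem_map.2 <|
      mem_of_superset (Metric.ball_mem_nhds _ (lt_min hε S.β_pos)) fun y hy => ?_
    obtain ⟨w, hw0, hw⟩ := exists_lift_of_dist_lt x.point (lt_min hε S.β_pos) (min_le_right _ _) hy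
    have hxw : ∀ n, dist (x.point.coord n) (w.coord n) < min (min ε₀ ε₁) S.β := by
      refine h₂ _ _ fun m => ?_
      obtain ⟨z, hz, hwz⟩ := hw m
      have := h S.K le_rfl _ _ (hz.trans_le (min_le_left _ _))
      rwa [Nat.succ_mul, x.point.iterate_coord_add, ← hwz, dist_comm] at this
    have hwx : S.UnstableEquiv w x.point := unstableEquiv_of_dist_coord_le fun n => by
      rw [dist_comm]
      exact (hxw n).le.trans (min_le_right _ _)
    obtain ⟨p, hp, hxp⟩ := x.exists_unstableEquiv
    have hws := @hs ⟨w, p, hp, hwx.trans hxp⟩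
      ⟨fun n => (hxw n).trans_le ((min_le_left _ _).trans (min_le_left _ _)),
        h₁ _ _ fun n => (hxw n).trans_le ((min_le_left _ _).trans (min_le_right _ _))⟩
    rw [mem_preimage, ← hw0]
    exact hws

theorem isCompact_setOf_dist_coord_le (p : S.Solenoid) (hp : p ∈ P) :
    IsCompact {y : S.UnstableSet P | ∀ n, dist (p.coord n) (y.point.coord n) ≤ S.β / 2} := by
  set C := {y : S.UnstableSet P | ∀ n, dist (p.coord n) (y.point.coord n) ≤ S.β / 2}
  refine isCompact_iff_ultrafilter_le_nhds.2 fun F hF => ?_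
  have hlim : ∀ n, ∃ z : Y, Tendsto (fun y : S.UnstableSet P => y.point.coord n) F (𝓝 z) := by
    intro n
    obtain ⟨z, -, hz⟩ := isCompact_univ.ultrafilter_le_nhds
      (F.map fun y : S.UnstableSet P => y.point.coord n) (by simp)
    exact ⟨z, hz⟩
  choose z hz using hlim
  have hgz : ∀ n, S.g (z (n + 1)) = z n := by
    intro n
    refine tendsto_nhds_unique ((S.continuous_g.tendsto _).comp (hz (n + 1))) ?_
    refine (hz n).congr fun y => (y.point.g_coord_succ n).symm
  have hFC : ∀ᶠ y in (F : Filter (S.UnstableSet P)), y ∈ C := le_principal_iff.1 hF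
  have hpz : ∀ n, dist (p.coord n) (z n) ≤ S.β / 2 := fun n =>
    le_of_tendsto (tendsto_const_nhds.dist (hz n)) (hFC.mono fun y hy => hy n)
  have hzp : S.UnstableEquiv ⟨z, hgz⟩ p := unstableEquiv_of_dist_coord_le fun n => by
    rw [dist_comm]
    exact (hpz n).trans (half_le_self S.β_pos.le)
  refine ⟨⟨⟨z, hgz⟩, p, hp, hzp⟩, hpz, ?_⟩
  have hCs : ∀ u ∈ C, ∀ v ∈ C, ∀ n, dist (u.point.coord n) (v.point.coord n) ≤ S.β := by
    intro u hu v hv n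
    have := dist_triangle_left (u.point.coord n) (v.point.coord n) (p.coord n)
    linarith [hu n, hv n]
  refine le_trans (le_inf ?_ hF) (comap_proj_inf_principal_le hCs hpz)
  exact map_le_iff_le_comap.1 (hz 0)

theorem isCompact_closure_core (hfin : P.Finite) :
    IsCompact (closure (core P (S.β / 2) : Set (S.UnstableSet P))) := by
  have h : IsCompact (⋃ p ∈ P,
      {y : S.UnstableSet P | ∀ n, dist (p.coord n) (y.point.coord n) ≤ S.β / 2}) :=
    hfin.isCompact_biUnion fun p hp => isCompact_setOf_dist_coord_le p hp
  exact h.closure_of_subset (biUnion_mono Subset.rfl fun p _ y hy n => (hy.1 n).le)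

variable (hinv : S.shift '' P = P)

theorem continuous_map : Continuous (map hinv) := by
  refine continuous_iff_continuousAt.2 fun x => ((hasBasis_nhds x).tendsto_iff
    (hasBasis_nhds (map hinv x))).2 fun ε hε => ?_
  obtain ⟨δ₁, hδ₁, h₁⟩ := S.exists_dist_lt_of_coord hε
  obtain ⟨δ, hδ, h⟩ := S.exists_dist_iterate_lt 1 (lt_min hε hδ₁)
  refine ⟨δ, hδ, fun y hy => ?_⟩
  have h2 := fun n => h 1 le_rfl _ _ (hy.1 n)
  exact ⟨fun n => (h2 n).trans_le (min_le_left _ _),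
    h₁ _ _ fun n => (h2 n).trans_le (min_le_right _ _)⟩

theorem map_iterate_point (n : ℕ) (x : S.UnstableSet P) :
    ((map hinv)^[n] x).point = S.shift^[n] x.point := by
  induction n with
  | zero => rfl
  | succ n ih =>
    rw [Function.iterate_succ_apply', Function.iterate_succ_apply', ← ih]
    rfl

/-- Every germ occurs on the image of `X^u(P, β/2)` under a fixed power of `φ`. -/
theorem exists_map_iterate_core (hmix : S.IsMixing) :
    ∃ N : ℕ, 0 < N ∧ ∀ x : S.UnstableSet P,
      ∃ x' ∈ (map hinv)^[N] '' core P (S.β / 2), Filter.map proj (𝓝 x) = Filter.map proj (𝓝 x') := by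
  rcases P.eq_empty_or_nonempty with rfl | ⟨p, hp⟩
  · refine ⟨1, one_pos, fun x => ?_⟩
    obtain ⟨p, hp, -⟩ := x.exists_unstableEquiv
    exact hp.elim
  let p' : S.UnstableSet P := ⟨p, p, hp, unstableEquiv_of_dist_coord_le fun n => by
    simpa using S.β_pos.le⟩
  have hmem : proj '' nhd P p (S.β / 2) ∈ Filter.map (proj : S.UnstableSet P → Y) (𝓝 p') :=
    image_mem_map (nhd_mem_nhds p' (half_pos S.β_pos))
  rw [map_proj_nhds] at hmem
  obtain ⟨δ, hδ, hball⟩ := Metric.mem_nhds_iff.1 (mem_map.1 hmem)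
  obtain ⟨m, hm⟩ := exists_iterate_image_ball_eq_univ hmix (p.coord S.K) hδ
  refine ⟨S.K + m, Nat.add_pos_left S.K_pos _, fun x => ?_⟩
  obtain ⟨u, hxu⟩ := S.surjective_g.iterate S.K (x.point.coord S.K)
  obtain ⟨v, hv, rfl⟩ := hm ▸ mem_univ u
  obtain ⟨w, hw, hwv⟩ := hball hv
  refine ⟨_, mem_image_of_mem _ (mem_biUnion hp hw), ?_⟩
  have hw0 : w.point.coord 0 = S.g^[S.K] v := hwv
  have e : ((map hinv)^[S.K + m] w).point.coord S.K = x.point.coord S.K := by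
    have h1 := w.point.iterate_coord_add S.K 0
    rw [zero_add] at h1
    rw [map_iterate_point, Solenoid.shift_iterate_coord, add_comm, Function.iterate_add_apply, h1,
      hw0, ← Function.iterate_add_apply, add_comm, Function.iterate_add_apply, hxu]
  rw [map_proj_nhds, map_proj_nhds, e]

end UnstableSet

end WielerSystem
theorem mainTheorem8 {Y : Type*} [MetricSpace Y] [CompactSpace Y]
    (S : WielerSystem Y) (hmix : S.IsMixing)
    (P : Set S.Solenoid) (hfin : P.Finite) (hinv : S.shift '' P = P)
    (K₀ : ℕ) (εY : ℝ) (hconst : S.AdmissibleConstants K₀ εY) :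
    Equivalence (WielerSystem.UnstableSet.SimZero P εY) ∧
    CompactSpace (Quot (WielerSystem.UnstableSet.SimZero P εY)) ∧
    (∃ K₂ : ℕ, 0 < K₂ ∧
      IsCompact ((WielerSystem.UnstableSet.map hinv)^[K₂] ''
        closure (WielerSystem.UnstableSet.core P (S.β / 2))) ∧
      ∀ x : S.UnstableSet P,
        ∃ x' ∈ (WielerSystem.UnstableSet.map hinv)^[K₂] ''
          WielerSystem.UnstableSet.core P (S.β / 2),
          WielerSystem.UnstableSet.SimZero P εY x x') ∧
    IsLocalHomeomorph (Quot.mk (WielerSystem.UnstableSet.SimZero P εY)) ∧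
    (∀ z : Quot (WielerSystem.UnstableSet.SimZero P εY),
      ∃ V : Set (Quot (WielerSystem.UnstableSet.SimZero P εY)),
        IsOpen V ∧ z ∈ V ∧ T2Space V) := by
  have hpos := hconst.pos
  have hlt : εY ≤ S.β / 2 := by linarith [hconst.lt, S.β_pos]
  obtain ⟨N, hN, h⟩ := WielerSystem.UnstableSet.exists_map_iterate_core hinv hmix
  have hcompact := (WielerSystem.UnstableSet.isCompact_closure_core hfin).image
    ((WielerSystem.UnstableSet.continuous_map hinv).iterate N)
  have hsim : ∀ x : S.UnstableSet P, ∃ x' ∈ (WielerSystem.UnstableSet.map hinv)^[N] ''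
      WielerSystem.UnstableSet.core P (S.β / 2), WielerSystem.UnstableSet.SimZero P εY x x' :=
    fun x => (h x).imp fun x' hx' =>
      ⟨hx'.1, (WielerSystem.UnstableSet.simZero_iff hpos hlt).2 hx'.2⟩
  refine ⟨WielerSystem.UnstableSet.equivalence_simZero hpos hlt, ⟨?_⟩,
    ⟨N, hN, hcompact, hsim⟩, WielerSystem.UnstableSet.isLocalHomeomorph_quot_mk hpos hlt,
    WielerSystem.UnstableSet.exists_isOpen_t2Space_quot hpos hlt⟩
  convert hcompact.image
    (continuous_quot_mk (r := WielerSystem.UnstableSet.SimZero P εY)) using 1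
  refine (eq_univ_of_forall fun z => ?_).symm
  obtain ⟨x, rfl⟩ := Quot.exists_rep z
  obtain ⟨x', hx', hxx'⟩ := hsim x
  exact ⟨x', image_mono subset_closure hx', (Quot.sound hxx').symm⟩
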